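/- Let $d\ge 1$ and let $K\subset\mathbb R^d$ be a (compact, not necessarily convex) polytope, i.e. a finite union of $d$-dimensional convex polytopes whose boundary is decomposed into finitely many flat faces $f$ of dimension $d-1$ overlapping only in sets of $(d-1)$-dimensional measure zero, with constant unit outward normal $n_f$ on $f$. For an integer $k\ge 0$ let $\mathbb Q_k(K)$ be the space of polynomials in $d$ variables of degree at most $k$ in each variable, let $\mathbb Q_{[k]}(K)$ be the span of the monomials whose largest exponent is exactly $k$, and let $\mathbb Q_k(f)$ be the space of polynomials of degree at most $k$ in each of $d-1$ affine coordinates fixed on the hyperplane of $f$; for $k<0$ all these spaces are $\{0\}$. Put $$\mathcal H_l(\partial K)=\{g\in L^2(\partial K):\ g|_f\in\mathbb Q_l(f)\ \text{for every face } f\}.$$ For integers $l_1,l_2,m_1,m_2$ let $$A=\{u\in H^1(K):\ u|_{\partial K}\in\mathcal H_{l_1}(\partial K),\ \Delta u\in\mathbb Q_{m_1}(K)\},\qquad B=\{u\in H^1(K):\ u|_{\partial K}\in\mathcal H_{l_2}(\partial K),\ \Delta u\in\mathbb Q_{[m_2]}(K)\},$$ where $u|_{\partial K}$ is the trace and $\Delta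 u$ the distributional Laplacian, with the convention that $A$ (resp. $B$) is $\{0\}$ if one of $l_1,m_1$ (resp. $l_2,m_2$) is smaller than $-1$; and let $$\mathbb H(K)=A^d+x\,B=\{q_0+x\,q_1:\ q_0\in A^d,\ q_1\in B\}.$$ Then every $q\in\mathbb H(K)$ has a normal trace $q\cdot n|_{\partial K}$ (the trace of $q$ on $\partial K$ dotted with the outward normal), and $$q\cdot n|_{\partial K}\in\mathcal H_{\max\{l_1,l_2\}}(\partial K),\qquad \operatorname{div}q\in L^2(K).$$ Consequently $\mathbb H(K)\subset H(\operatorname{div},K)=\{q\in L^2(K)^d:\ \operatorname{div}q\in L^2(K)\}$. In particular this holds for each space $\mathbb H_k(K)$, $k\ge 0$, obtained by letting $l_1,l_2,m_1,m_2$ depend on $k$. -/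

import Mathlib

open MeasureTheory Filter Topology
open scoped ContDiff Laplacian

noncomputable section

namespace HdivElement

/-- The Euclidean space `ℝᵈ`. -/
abbrev E (d : ℕ) : Type := EuclideanSpace ℝ (Fin d)

/-! ### Polynomial spaces -/

/-- `ℚ_k` in `σ` variables: real polynomials in which every variable occurs with degree at most
`k`; it is `{0}` for `k < 0`. -/
def polyQ (σ : Type) (k : ℤ) : Submodule ℝ (MvPolynomial σ ℝ) :=
  if k < 0 then ⊥ else MvPolynomial.restrictSupport ℝ {m : σ →₀ ℕ | ∀ i, (m i : ℤ) ≤ k}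

/-- `ℚ_[k]` in `σ` variables: the span of the monomials whose largest exponent is exactly `k`;
it is `{0}` for `k < 0`. -/
def polyQExact (σ : Type) (k : ℤ) : Submodule ℝ (MvPolynomial σ ℝ) :=
  if k < 0 then ⊥ else
    MvPolynomial.restrictSupport ℝ
      {m : σ →₀ ℕ | (∀ i, (m i : ℤ) ≤ k) ∧ ∃ i, (m i : ℤ) = k}

/-! ### Polytopes -/

/-- `S` is a finite nonempty union of convex polytopes (convex hulls of finite sets of points),
each of dimension exactly `k`. -/
def IsPolyhedralOfDim {d : ℕ} (k : ℕ) (S : Set (E d)) : Prop :=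
  ∃ T : Finset (Finset (E d)), T.Nonempty ∧
    (∀ s ∈ T, s.Nonempty ∧ Module.finrank ℝ (vectorSpan ℝ (s : Set (E d))) = k) ∧
    S = ⋃ s ∈ T, convexHull ℝ (s : Set (E d))

/-- A (not necessarily convex) non-degenerate polytope of `ℝᵈ`, together with the decomposition of
its boundary into finitely many flat faces of dimension `d - 1`, each with its unit outward
normal. Two faces meet in a set of vanishing `(d-1)`-dimensional measure; they may be coplanar. -/
structure Polytope (d : ℕ) where
  /-- the closed set `K` -/
  carrier : Set (E d)
  /-- `K` is `d`-dimensional and polyhedral -/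
  polyhedral : IsPolyhedralOfDim d carrier
  /-- labels of the faces -/
  Face : Type
  /-- there are finitely many faces -/
  finite_face : Finite Face
  /-- the faces, as closed subsets of `ℝᵈ` -/
  face : Face → Set (E d)
  /-- every face is polyhedral of dimension `d - 1` -/
  face_polyhedral : ∀ f, IsPolyhedralOfDim (d - 1) (face f)
  /-- the faces cover the boundary -/
  iUnion_face : ⋃ f, face f = frontier carrier
  /-- distinct faces do not overlap -/
  face_inter : ∀ f f', f ≠ f' → μH[(d : ℝ) - 1] (face f ∩ face f') = 0
  /-- the unit outward normal of each face -/
  normal : Face → E d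
  norm_normal : ∀ f, ‖normal f‖ = 1
  /-- the face `f` lies in the hyperplane `{x | normal f · x = offset f}` -/
  offset : Face → ℝ
  face_subset : ∀ f, ∀ x ∈ face f, inner ℝ (normal f) x = offset f
  /-- the normal points out of `K` -/
  outward : ∀ f, ∀ x ∈ face f, (∀ f', f' ≠ f → x ∉ face f') →
    ∃ ε > 0, ∀ t : ℝ, 0 < t → t < ε →
      x + t • normal f ∉ carrier ∧ x - t • normal f ∈ interior carrier

namespace Polytope

variable {d : ℕ}

/-- The hyperplane that carries the face `f`. -/
def hyperplane (K : Polytope d) (f : K.Face) : Set (E d) :=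
  {x | inner ℝ (K.normal f) x = K.offset f}

/-- Lebesgue measure on (the interior of) `K`. -/
def vol (K : Polytope d) : Measure (E d) := volume.restrict (interior K.carrier)

/-- The surface measure on `∂K`. -/
def surf (K : Polytope d) : Measure (E d) := μH[(d : ℝ) - 1].restrict (frontier K.carrier)

/-- Affine coordinates `ℝ^{d-1} ≃ hyperplane of f` on every face `f`; they identify polynomials
on `f` with polynomials in `d - 1` variables. -/
structure FaceCoordinates (K : Polytope d) where
  /-- the affine parametrization of the hyperplane of `f` -/
  param : K.Face → (E (d - 1) →ᵃ[ℝ] E d)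
  injective : ∀ f, Function.Injective (param f)
  range_eq : ∀ f, Set.range (param f) = K.hyperplane f

/-! ### Weak derivatives, `H¹(K)` and `H(div, K)` -/

/-- Test functions `C_c^∞` on the interior of `K`. -/
def IsTest (K : Polytope d) (ψ : E d → ℝ) : Prop :=
  ContDiff ℝ ∞ ψ ∧ HasCompactSupport ψ ∧ tsupport ψ ⊆ interior K.carrier

/-- The classical partial derivative `∂_i ψ`. -/
def pderiv (i : Fin d) (ψ : E d → ℝ) (x : E d) : ℝ :=
  fderiv ℝ ψ x (EuclideanSpace.single i 1)

/-- `v` is the weak partial derivative `∂_i u` on `K`, and lies in `L²(K)`. -/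
def HasWeakPartial (K : Polytope d) (i : Fin d) (u v : E d → ℝ) : Prop :=
  MemLp v 2 K.vol ∧
    ∀ ψ, K.IsTest ψ → ∫ x, u x * pderiv i ψ x ∂K.vol = - ∫ x, v x * ψ x ∂K.vol

/-- The Sobolev space `H¹(K)`. -/
def H1 (K : Polytope d) : Set (E d → ℝ) :=
  {u | MemLp u 2 K.vol ∧ ∀ i, ∃ v, K.HasWeakPartial i u v}

/-- `Δ u = w` on `K` in the sense of distributions. -/
def HasWeakLaplacian (K : Polytope d) (u w : E d → ℝ) : Prop :=
  ∀ ψ, K.IsTest ψ → ∫ x, u x * Δ ψ x ∂K.vol = ∫ x, w x * ψ x ∂K.vol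

/-- `div q = g` on `K` in the sense of distributions. -/
def HasWeakDiv (K : Polytope d) (q : E d → E d) (g : E d → ℝ) : Prop :=
  ∀ ψ, K.IsTest ψ → ∫ x, ∑ i, q x i * pderiv i ψ x ∂K.vol = - ∫ x, g x * ψ x ∂K.vol

/-- `H(div, K)`: the square integrable vector fields with square integrable divergence. -/
def Hdiv (K : Polytope d) : Set (E d → E d) :=
  {q | MemLp q 2 K.vol ∧ ∃ g, MemLp g 2 K.vol ∧ K.HasWeakDiv q g}

/-! ### Traces -/

/-- `g ∈ L²(∂K)` is the trace `u|_{∂K}` of `u ∈ H¹(K)`: there are functions smooth up to the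
boundary that converge to `u` in `H¹(K)` and whose restrictions to `∂K` converge to `g` in
`L²(∂K)`. -/
def IsTrace (K : Polytope d) (u g : E d → ℝ) : Prop :=
  u ∈ K.H1 ∧ MemLp g 2 K.surf ∧
    ∃ φ : ℕ → E d → ℝ, (∀ n, ContDiff ℝ ∞ (φ n)) ∧
      Tendsto (fun n => eLpNorm (φ n - u) 2 K.vol) atTop (𝓝 0) ∧
      (∀ i, ∃ v, K.HasWeakPartial i u v ∧
        Tendsto (fun n => eLpNorm (pderiv i (φ n) - v) 2 K.vol) atTop (𝓝 0)) ∧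
      Tendsto (fun n => eLpNorm (φ n - g) 2 K.surf) atTop (𝓝 0)

/-- `h ∈ L²(∂K)` is the normal trace `q · n|_{∂K}` of a field `q` with components in `H¹(K)`. -/
def IsNormalTrace (K : Polytope d) (q : E d → E d) (h : E d → ℝ) : Prop :=
  MemLp h 2 K.surf ∧
    ∃ γ : Fin d → E d → ℝ, (∀ i, K.IsTrace (fun x => q x i) (γ i)) ∧
      ∀ f, ∀ᵐ x ∂(K.surf.restrict (K.face f)), h x = ∑ i, γ i x * K.normal f i

/-- The space `𝓗_l(∂K)` of square integrable functions on `∂K` whose restriction to every face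
`f` is (almost everywhere) a polynomial in `ℚ_l(f)`. -/
def boundaryPoly (K : Polytope d) (c : K.FaceCoordinates) (l : ℤ) : Set (E d → ℝ) :=
  {g | MemLp g 2 K.surf ∧ ∀ f, ∃ p ∈ polyQ (Fin (d - 1)) l,
    ∀ᵐ x ∂(K.surf.restrict (K.face f)), ∀ y, c.param f y = x → g x = MvPolynomial.eval y.ofLp p}

/-! ### The discretisation spaces -/

/-- The functions `u ∈ H¹(K)` with `u|_{∂K} ∈ 𝓗_l(∂K)` and `Δ u ∈ P`, for a space `P` of
polynomials in `d` variables. -/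
def poissonSpace (K : Polytope d) (c : K.FaceCoordinates) (l : ℤ)
    (P : Submodule ℝ (MvPolynomial (Fin d) ℝ)) : Set (E d → ℝ) :=
  {u | u ∈ K.H1 ∧ (∃ g ∈ K.boundaryPoly c l, K.IsTrace u g) ∧
    ∃ p ∈ P, K.HasWeakLaplacian u (fun x => MvPolynomial.eval x.ofLp p)}

/-- The scalar functions that vanish (almost everywhere) on `K`. -/
def zeroSpace (K : Polytope d) : Set (E d → ℝ) := {u | u =ᵐ[K.vol] 0}

open scoped Classical in
/-- The block `A`, reduced to zero when one of its orders is below `-1`. -/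
def spaceA (K : Polytope d) (c : K.FaceCoordinates) (l₁ m₁ : ℤ) : Set (E d → ℝ) :=
  if l₁ < -1 ∨ m₁ < -1 then K.zeroSpace else K.poissonSpace c l₁ (polyQ (Fin d) m₁)

open scoped Classical in
/-- The block `B`, reduced to zero when one of its orders is below `-1`. -/
def spaceB (K : Polytope d) (c : K.FaceCoordinates) (l₂ m₂ : ℤ) : Set (E d → ℝ) :=
  if l₂ < -1 ∨ m₂ < -1 then K.zeroSpace else K.poissonSpace c l₂ (polyQExact (Fin d) m₂)

/-- The discretisation space `ℍ(K) = A^d + x B`. -/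
def spaceH (K : Polytope d) (c : K.FaceCoordinates) (l₁ l₂ m₁ m₂ : ℤ) : Set (E d → E d) :=
  {q | ∃ q₀ : E d → E d, ∃ q₁ : E d → ℝ,
    (∀ i, (fun x => q₀ x i) ∈ K.spaceA c l₁ m₁) ∧ q₁ ∈ K.spaceB c l₂ m₂ ∧
    ∀ x, q x = q₀ x + q₁ x • x}

end Polytope

end HdivElement

end

/-!
The members of `A` and `B` are `H¹` functions with piecewise polynomial traces, and both properties
pass to the components of `q₀ + x q₁` and to its normal trace.

* `K` is compact, so multiplication by a smooth function `η` preserves `H¹(K)` (Leibniz rule, moved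
  onto the test function) and turns a trace `g` into the trace `η g` (`IsTrace.smooth_mul`). With
  `η = x_i`, every component `q_i = q₀_i + x_i q₁` of `q ∈ ℍ(K)` is an `H¹` function with trace
  `γ_i + x_i g`, where `γ_i` and `g` are the traces of `q₀_i` and `q₁`.
* A field with components in `H¹(K)` has the weak divergence `∑ i, ∂_i q_i ∈ L²(K)`
  (`hasWeakDiv_sum`).
* On a face `f` with normal `n` the normal trace is `∑ i, n_i γ_i + (n · x) g`. Since `f` is flat,
  `n · x` is constant on `f`, so that multiplication by `x` does not raise the degree there, and the
  normal trace is a polynomial in `ℚ_{max(l₁, l₂)}(f)`.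
-/

open MeasureTheory Filter Topology
open scoped ContDiff Laplacian

noncomputable section

namespace HdivElement

/-! ### Polynomial spaces and polyhedral sets -/

theorem polyQ_mono (σ : Type) {k l : ℤ} (h : k ≤ l) : polyQ σ k ≤ polyQ σ l := by
  unfold polyQ
  by_cases hk : k < 0
  · simp [hk]
  · rw [if_neg hk, if_neg (by omega)]
    exact MvPolynomial.restrictSupport_mono ℝ fun m hm i => (hm i).trans h

theorem IsPolyhedralOfDim.isCompact {d k : ℕ} {S : Set (E d)} (h : IsPolyhedralOfDim k S) :
    IsCompact S := by
  obtain ⟨T, -, -, rfl⟩ := h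
  exact T.finite_toSet.isCompact_biUnion fun s _ => s.finite_toSet.isCompact_convexHull ℝ

/-! ### Convergence in `L²` -/

theorem tendsto_eLpNorm_two_add {α : Type*} [MeasurableSpace α] {μ : Measure α}
    {φ ψ : ℕ → α → ℝ} {u v : α → ℝ}
    (hφ : ∀ n, AEStronglyMeasurable (φ n - u) μ) (hψ : ∀ n, AEStronglyMeasurable (ψ n - v) μ)
    (h₁ : Tendsto (fun n => eLpNorm (φ n - u) 2 μ) atTop (𝓝 0))
    (h₂ : Tendsto (fun n => eLpNorm (ψ n - v) 2 μ) atTop (𝓝 0)) :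
    Tendsto (fun n => eLpNorm ((φ n + ψ n) - (u + v)) 2 μ) atTop (𝓝 0) := by
  have h := h₁.add h₂
  rw [add_zero] at h
  refine tendsto_of_tendsto_of_tendsto_of_le_of_le tendsto_const_nhds h (fun _ => zero_le) ?_
  intro n
  have e : (φ n + ψ n) - (u + v) = (φ n - u) + (ψ n - v) := by ring
  simp only [e]
  exact eLpNorm_add_le (hφ n) (hψ n) (by norm_num)

theorem tendsto_eLpNorm_two_mul_of_bound {α : Type*} [MeasurableSpace α] {μ : Measure α}
    {η : α → ℝ} {C : ℝ} (hη : ∀ᵐ x ∂μ, ‖η x‖ ≤ C) {φ : ℕ → α → ℝ} {u : α → ℝ}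
    (h : Tendsto (fun n => eLpNorm (φ n - u) 2 μ) atTop (𝓝 0)) :
    Tendsto (fun n => eLpNorm (η * φ n - η * u) 2 μ) atTop (𝓝 0) := by
  have h' := ENNReal.Tendsto.const_mul (a := ENNReal.ofReal C) h (Or.inr ENNReal.ofReal_ne_top)
  rw [mul_zero] at h'
  refine tendsto_of_tendsto_of_tendsto_of_le_of_le tendsto_const_nhds h' (fun _ => zero_le) ?_
  intro n
  refine eLpNorm_le_mul_eLpNorm_of_ae_le_mul ?_ 2
  filter_upwards [hη] with x hx
  have e : (η * φ n - η * u) x = η x * (φ n - u) x := by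
    simp only [Pi.sub_apply, Pi.mul_apply]; ring
  rw [e, norm_mul]
  gcongr

namespace Polytope

variable {d : ℕ}

/-! ### The measures on a polytope and its boundary -/

section Measures

variable (K : Polytope d)

theorem isCompact_carrier : IsCompact K.carrier := K.polyhedral.isCompact

theorem isCompact_face (f : K.Face) : IsCompact (K.face f) := (K.face_polyhedral f).isCompact

theorem ae_vol_mem : ∀ᵐ x ∂K.vol, x ∈ K.carrier := by
  filter_upwards [ae_restrict_mem isOpen_interior.measurableSet] with x hx
  exact interior_subset hx

theorem ae_surf_mem : ∀ᵐ x ∂K.surf, x ∈ K.carrier := by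
  filter_upwards [ae_restrict_mem isClosed_frontier.measurableSet] with x hx
  exact K.isCompact_carrier.isClosed.frontier_subset hx

instance isFiniteMeasure_vol : IsFiniteMeasure K.vol :=
  ⟨by
    rw [vol, Measure.restrict_apply_univ]
    exact (measure_mono interior_subset).trans_lt K.isCompact_carrier.measure_lt_top⟩

theorem exists_ae_bound {μ : Measure (E d)} (hμ : ∀ᵐ x ∂μ, x ∈ K.carrier) {η : E d → ℝ}
    (hη : Continuous η) : ∃ C, ∀ᵐ x ∂μ, ‖η x‖ ≤ C := by
  obtain ⟨C, hC⟩ := K.isCompact_carrier.exists_bound_of_continuousOn hη.continuousOn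
  exact ⟨C, hμ.mono hC⟩

theorem memLp_continuous_mul {μ : Measure (E d)} (hμ : ∀ᵐ x ∂μ, x ∈ K.carrier)
    {η u : E d → ℝ} (hη : Continuous η) (hu : MemLp u 2 μ) : MemLp (η * u) 2 μ := by
  obtain ⟨C, hC⟩ := K.exists_ae_bound hμ hη
  refine hu.of_le_mul (c := C) (hη.aestronglyMeasurable.mul hu.1) ?_
  filter_upwards [hC] with x hx
  rw [Pi.mul_apply, norm_mul]
  gcongr

theorem integrable_mul_continuous {u η : E d → ℝ} (hu : MemLp u 2 K.vol) (hη : Continuous η) :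
    Integrable (fun x => u x * η x) K.vol := by
  have h := (K.memLp_continuous_mul K.ae_vol_mem hη hu).integrable (by norm_num)
  exact h.congr (Eventually.of_forall fun x => mul_comm _ _)

end Measures

/-! ### Weak derivatives -/

theorem continuous_pderiv {ψ : E d → ℝ} (hψ : ContDiff ℝ ∞ ψ) (i : Fin d) :
    Continuous (pderiv i ψ) :=
  (hψ.continuous_fderiv (by simp)).clm_apply continuous_const

theorem pderiv_add {φ ψ : E d → ℝ} (hφ : ContDiff ℝ ∞ φ) (hψ : ContDiff ℝ ∞ ψ) (i : Fin d) :
    pderiv i (φ + ψ) = pderiv i φ + pderiv i ψ := by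
  funext x
  simp only [pderiv, Pi.add_apply]
  rw [fderiv_add (hφ.differentiable (by simp) x) (hψ.differentiable (by simp) x)]
  rfl

theorem pderiv_mul {φ ψ : E d → ℝ} (hφ : ContDiff ℝ ∞ φ) (hψ : ContDiff ℝ ∞ ψ) (i : Fin d) :
    pderiv i (φ * ψ) = φ * pderiv i ψ + pderiv i φ * ψ := by
  funext x
  simp only [pderiv, Pi.add_apply, Pi.mul_apply]
  rw [fderiv_mul (hφ.differentiable (by simp) x) (hψ.differentiable (by simp) x)]
  simp [mul_comm]

variable {K : Polytope d}

theorem IsTest.smooth_mul {η ψ : E d → ℝ} (hη : ContDiff ℝ ∞ η) (hψ : K.IsTest ψ) :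
    K.IsTest (η * ψ) :=
  ⟨hη.mul hψ.1, hψ.2.1.mul_left, (tsupport_mul_subset_right).trans hψ.2.2⟩

theorem HasWeakPartial.add {i : Fin d} {u u' v v' : E d → ℝ} (hu : MemLp u 2 K.vol)
    (hu' : MemLp u' 2 K.vol) (h : K.HasWeakPartial i u v) (h' : K.HasWeakPartial i u' v') :
    K.HasWeakPartial i (u + u') (v + v') := by
  refine ⟨h.1.add h'.1, fun ψ hψ => ?_⟩
  have c₁ := continuous_pderiv hψ.1 i
  have c₀ := hψ.1.continuous
  simp only [Pi.add_apply, add_mul]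
  rw [integral_add (K.integrable_mul_continuous hu c₁) (K.integrable_mul_continuous hu' c₁),
    integral_add (K.integrable_mul_continuous h.1 c₀) (K.integrable_mul_continuous h'.1 c₀),
    h.2 ψ hψ, h'.2 ψ hψ]
  ring

/-- The Leibniz rule for the product of a smooth function and an `H¹` function. -/
theorem HasWeakPartial.smooth_mul {i : Fin d} {η u v : E d → ℝ} (hη : ContDiff ℝ ∞ η)
    (hu : MemLp u 2 K.vol) (h : K.HasWeakPartial i u v) :
    K.HasWeakPartial i (η * u) (η * v + pderiv i η * u) := by
  have cη := hη.continuous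
  have cη' := continuous_pderiv hη i
  refine ⟨(K.memLp_continuous_mul K.ae_vol_mem cη h.1).add
    (K.memLp_continuous_mul K.ae_vol_mem cη' hu), fun ψ hψ => ?_⟩
  have cψ := hψ.1.continuous
  -- `η ψ` is again a test function: the derivative falling on `η` gives the second summand.
  have key := h.2 _ (hψ.smooth_mul hη)
  have I₁ : Integrable (fun x => u x * pderiv i (η * ψ) x) K.vol :=
    K.integrable_mul_continuous hu (continuous_pderiv (hη.mul hψ.1) i)
  have I₂ : Integrable (fun x => u x * (pderiv i η x * ψ x)) K.vol :=
    K.integrable_mul_continuous hu (cη'.mul cψ)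
  have I₃ : Integrable (fun x => v x * (η x * ψ x)) K.vol :=
    K.integrable_mul_continuous h.1 (cη.mul cψ)
  calc ∫ x, (η * u) x * pderiv i ψ x ∂K.vol
      = ∫ x, (u x * pderiv i (η * ψ) x - u x * (pderiv i η x * ψ x)) ∂K.vol := by
        congr 1
        funext x
        rw [pderiv_mul hη hψ.1]
        simp only [Pi.mul_apply, Pi.add_apply]
        ring
    _ = -((∫ x, v x * (η x * ψ x) ∂K.vol) + ∫ x, u x * (pderiv i η x * ψ x) ∂K.vol) := by
        rw [integral_sub I₁ I₂, key]
        simp only [Pi.mul_apply]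
        ring
    _ = -∫ x, (η * v + pderiv i η * u) x * ψ x ∂K.vol := by
        rw [← integral_add I₃ I₂]
        congr 2
        funext x
        simp only [Pi.mul_apply, Pi.add_apply]
        ring

/-- The sum of the weak partial derivatives `∂_i q_i` is the weak divergence of `q`. -/
theorem hasWeakDiv_sum {q : E d → E d} {v : Fin d → E d → ℝ}
    (hq : ∀ i, MemLp (fun x => q x i) 2 K.vol)
    (hv : ∀ i, K.HasWeakPartial i (fun x => q x i) (v i)) :
    K.HasWeakDiv q (fun x => ∑ i, v i x) := by
  intro ψ hψ
  simp only [Finset.sum_mul]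
  rw [integral_finsetSum _ fun i _ =>
      K.integrable_mul_continuous (hq i) (continuous_pderiv hψ.1 i),
    integral_finsetSum _ fun i _ => K.integrable_mul_continuous (hv i).1 hψ.1.continuous,
    ← Finset.sum_neg_distrib]
  exact Finset.sum_congr rfl fun i _ => (hv i).2 ψ hψ

theorem memLp_of_components {μ : Measure (E d)} {q : E d → E d}
    (hq : ∀ i, MemLp (fun x => q x i) 2 μ) : MemLp q 2 μ := by
  have e : q = fun x => ∑ i, q x i • EuclideanSpace.single i (1 : ℝ) := by
    funext x
    ext j
    simp [Pi.single_apply]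
  rw [e]
  refine memLp_finsetSum _ fun i _ => ?_
  refine (hq i).of_le_mul (c := 1) ((hq i).1.smul_const _) (Eventually.of_forall fun x => ?_)
  simp [norm_smul]

/-! ### Traces -/

theorem IsTrace.add {u u' g g' : E d → ℝ} (h : K.IsTrace u g) (h' : K.IsTrace u' g') :
    K.IsTrace (u + u') (g + g') := by
  obtain ⟨⟨hu, hu₁⟩, hg, φ, hφ, hφu, hφv, hφg⟩ := h
  obtain ⟨⟨hu', hu₁'⟩, hg', φ', hφ', hφu', hφv', hφg'⟩ := h'
  refine ⟨⟨hu.add hu', fun i => ?_⟩, hg.add hg', fun n => φ n + φ' n,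
    fun n => (hφ n).add (hφ' n), ?_, fun i => ?_, ?_⟩
  · obtain ⟨v, hv⟩ := hu₁ i
    obtain ⟨v', hv'⟩ := hu₁' i
    exact ⟨_, hv.add hu hu' hv'⟩
  · exact tendsto_eLpNorm_two_add
      (fun n => (hφ n).continuous.aestronglyMeasurable.sub hu.1)
      (fun n => (hφ' n).continuous.aestronglyMeasurable.sub hu'.1) hφu hφu'
  · obtain ⟨v, hv, hlim⟩ := hφv i
    obtain ⟨v', hv', hlim'⟩ := hφv' i
    refine ⟨v + v', hv.add hu hu' hv', ?_⟩
    simp only [fun n => pderiv_add (hφ n) (hφ' n) i]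
    exact tendsto_eLpNorm_two_add
      (fun n => (continuous_pderiv (hφ n) i).aestronglyMeasurable.sub hv.1.1)
      (fun n => (continuous_pderiv (hφ' n) i).aestronglyMeasurable.sub hv'.1.1) hlim hlim'
  · exact tendsto_eLpNorm_two_add
      (fun n => (hφ n).continuous.aestronglyMeasurable.sub hg.1)
      (fun n => (hφ' n).continuous.aestronglyMeasurable.sub hg'.1) hφg hφg'

/-- Multiplication by a smooth function commutes with taking traces. -/
theorem IsTrace.smooth_mul {η u g : E d → ℝ} (hη : ContDiff ℝ ∞ η) (h : K.IsTrace u g) :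
    K.IsTrace (η * u) (η * g) := by
  obtain ⟨⟨hu, hu₁⟩, hg, φ, hφ, hφu, hφv, hφg⟩ := h
  have cη := hη.continuous
  obtain ⟨C, hC⟩ := K.exists_ae_bound K.ae_vol_mem cη
  obtain ⟨D, hD⟩ := K.exists_ae_bound K.ae_surf_mem cη
  refine ⟨⟨K.memLp_continuous_mul K.ae_vol_mem cη hu, fun i => ?_⟩,
    K.memLp_continuous_mul K.ae_surf_mem cη hg, fun n => η * φ n,
    fun n => hη.mul (hφ n), tendsto_eLpNorm_two_mul_of_bound hC hφu, fun i => ?_,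
    tendsto_eLpNorm_two_mul_of_bound hD hφg⟩
  · obtain ⟨v, hv⟩ := hu₁ i
    exact ⟨_, hv.smooth_mul hη hu⟩
  · obtain ⟨v, hv, hlim⟩ := hφv i
    refine ⟨_, hv.smooth_mul hη hu, ?_⟩
    have cη' := continuous_pderiv hη i
    obtain ⟨C', hC'⟩ := K.exists_ae_bound K.ae_vol_mem cη'
    simp only [fun n => pderiv_mul hη (hφ n) i]
    refine tendsto_eLpNorm_two_add (fun n => ?_) (fun n => ?_)
      (tendsto_eLpNorm_two_mul_of_bound hC hlim) (tendsto_eLpNorm_two_mul_of_bound hC' hφu)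
    · exact (cη.mul (continuous_pderiv (hφ n) i)).aestronglyMeasurable.sub
        (cη.aestronglyMeasurable.mul hv.1.1)
    · exact (cη'.mul (hφ n).continuous).aestronglyMeasurable.sub
        (cη'.aestronglyMeasurable.mul hu.1)

theorem isTrace_zero_of_mem_zeroSpace {u : E d → ℝ} (hu : u ∈ K.zeroSpace) : K.IsTrace u 0 := by
  have hu : u =ᵐ[K.vol] 0 := hu
  have hw : ∀ i, K.HasWeakPartial i u 0 := fun i => by
    refine ⟨MemLp.zero, fun ψ _ => ?_⟩
    have e : (fun x => u x * pderiv i ψ x) =ᵐ[K.vol] fun _ => 0 := by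
      filter_upwards [hu] with x hx
      simp [hx]
    rw [integral_congr_ae e]
    simp
  refine ⟨⟨(memLp_congr_ae hu).2 MemLp.zero, fun i => ⟨0, hw i⟩⟩, MemLp.zero, fun _ => 0,
    fun _ => contDiff_const, ?_, fun i => ⟨0, hw i, ?_⟩, ?_⟩
  · have e : eLpNorm ((0 : E d → ℝ) - u) 2 K.vol = 0 := by
      rw [zero_sub, eLpNorm_neg, eLpNorm_congr_ae hu, eLpNorm_zero]
    simp only [e]
    exact tendsto_const_nhds
  · have e : pderiv i (0 : E d → ℝ) = 0 := by
      funext x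
      simp [pderiv]
    simp [e]
  · simp

/-! ### Piecewise polynomial traces -/

variable {c : K.FaceCoordinates}

theorem zero_mem_boundaryPoly (l : ℤ) : (0 : E d → ℝ) ∈ K.boundaryPoly c l :=
  ⟨MemLp.zero, fun _ => ⟨0, Submodule.zero_mem _, Eventually.of_forall fun _ _ _ => by simp⟩⟩

theorem exists_trace_of_mem_spaceA {l m : ℤ} {u : E d → ℝ} (hu : u ∈ K.spaceA c l m) :
    ∃ g ∈ K.boundaryPoly c l, K.IsTrace u g := by
  unfold spaceA at hu
  split_ifs at hu
  · exact ⟨0, zero_mem_boundaryPoly l, isTrace_zero_of_mem_zeroSpace hu⟩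
  · exact hu.2.1

theorem exists_trace_of_mem_spaceB {l m : ℤ} {u : E d → ℝ} (hu : u ∈ K.spaceB c l m) :
    ∃ g ∈ K.boundaryPoly c l, K.IsTrace u g := by
  unfold spaceB at hu
  split_ifs at hu
  · exact ⟨0, zero_mem_boundaryPoly l, isTrace_zero_of_mem_zeroSpace hu⟩
  · exact hu.2.1

/-- Functions given face by face glue to a function on `∂K`, since faces overlap in null sets. -/
theorem exists_memLp_glue (K : Polytope d) (F : K.Face → E d → ℝ)
    (hF : ∀ f, MemLp (F f) 2 K.surf) :
    ∃ h, MemLp h 2 K.surf ∧ ∀ f, ∀ᵐ x ∂(K.surf.restrict (K.face f)), h x = F f x := by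
  classical
  have := K.finite_face
  have := Fintype.ofFinite K.Face
  have hmeas : ∀ f, MeasurableSet (K.face f) := fun f => (K.isCompact_face f).measurableSet
  refine ⟨fun x => ∑ f, (K.face f).indicator (F f) x,
    memLp_finsetSum _ fun f _ => (hF f).indicator (hmeas f), fun f => ?_⟩
  have hnull : ∀ f', ∀ᵐ x ∂(K.surf.restrict (K.face f)), f' ≠ f → x ∉ K.face f' := by
    intro f'
    by_cases hf : f' = f
    · simp [hf]
    · have h0 : (K.surf.restrict (K.face f)) (K.face f') = 0 := by
        rw [Measure.restrict_apply (hmeas f')]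
        exact le_antisymm ((Measure.restrict_apply_le _ _).trans_eq (K.face_inter f' f hf))
          zero_le
      filter_upwards [measure_eq_zero_iff_ae_notMem.1 h0] with x hx _ using hx
  filter_upwards [ae_restrict_mem (hmeas f), ae_all_iff.2 hnull] with x hx hx'
  rw [Finset.sum_eq_single f]
  · exact Set.indicator_of_mem hx _
  · intro f' _ hf'
    exact Set.indicator_of_notMem (hx' f' hf') _
  · simp

/-- The normal trace of `q₀ + q₁ x` in terms of the traces `γ i` of the components of `q₀` and the
trace `g` of `q₁`: it has the polynomial degree of `γ` and `g`, because `normal f · x` is constant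
on the face `f`. -/
theorem exists_normalTrace {l₁ l₂ : ℤ} {q : E d → E d} {γ : Fin d → E d → ℝ} {g : E d → ℝ}
    (hγ : ∀ i, γ i ∈ K.boundaryPoly c l₁) (hg : g ∈ K.boundaryPoly c l₂)
    (hq : ∀ i, K.IsTrace (fun x => q x i) (γ i + (fun x => x i) * g)) :
    ∃ h ∈ K.boundaryPoly c (max l₁ l₂), K.IsNormalTrace q h := by
  obtain ⟨h, hh, hface⟩ := K.exists_memLp_glue
    (fun f x => ∑ i, (γ i + (fun x : E d => x i) * g) x * K.normal f i)
    (fun f => memLp_finsetSum _ fun i _ => by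
      simpa only [mul_comm] using (hq i).2.1.const_mul (K.normal f i))
  refine ⟨h, ⟨hh, fun f => ?_⟩, hh, _, hq, hface⟩
  choose p hp hpγ using fun i => (hγ i).2 f
  obtain ⟨r, hr, hrg⟩ := hg.2 f
  refine ⟨∑ i, K.normal f i • p i + K.offset f • r, ?_, ?_⟩
  · exact Submodule.add_mem _
      (Submodule.sum_mem _ fun i _ =>
        Submodule.smul_mem _ _ (polyQ_mono _ (le_max_left l₁ l₂) (hp i)))
      (Submodule.smul_mem _ _ (polyQ_mono _ (le_max_right l₁ l₂) hr))
  · filter_upwards [hface f, ae_all_iff.2 hpγ, hrg,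
      ae_restrict_mem (K.isCompact_face f).measurableSet] with x hx hxγ hxg hxf y hy
    have hoff : ∑ i, x i * K.normal f i = K.offset f := by
      rw [← K.face_subset f x hxf, PiLp.inner_apply]
      simp
    rw [hx, map_add, map_sum]
    simp only [MvPolynomial.smul_eval, ← hxg y hy, ← fun i => hxγ i y hy, Pi.add_apply,
      Pi.mul_apply, ← hoff, add_mul, Finset.sum_add_distrib, Finset.sum_mul]
    congr 1
    · exact Finset.sum_congr rfl fun i _ => mul_comm _ _
    · exact Finset.sum_congr rfl fun i _ => by ring

/-- A field with components in `H¹(K)` has a square integrable weak divergence. -/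
theorem exists_hasWeakDiv {q : E d → E d} (hq : ∀ i, (fun x => q x i) ∈ K.H1) :
    ∃ g, MemLp g 2 K.vol ∧ K.HasWeakDiv q g := by
  choose v hv using fun i => (hq i).2 i
  exact ⟨_, memLp_finsetSum _ fun i _ => (hv i).1, hasWeakDiv_sum (fun i => (hq i).1) hv⟩

theorem exists_traces_of_mem_spaceH {l₁ l₂ m₁ m₂ : ℤ} {q : E d → E d}
    (hq : q ∈ K.spaceH c l₁ l₂ m₁ m₂) :
    ∃ γ : Fin d → E d → ℝ, ∃ g : E d → ℝ, (∀ i, γ i ∈ K.boundaryPoly c l₁) ∧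
      g ∈ K.boundaryPoly c l₂ ∧
      ∀ i, K.IsTrace (fun x => q x i) (γ i + (fun x => x i) * g) := by
  obtain ⟨q₀, q₁, h₀, h₁, e⟩ := hq
  choose γ hγ hγt using fun i => exists_trace_of_mem_spaceA (h₀ i)
  obtain ⟨g, hg, hgt⟩ := exists_trace_of_mem_spaceB h₁
  refine ⟨γ, g, hγ, hg, fun i => ?_⟩
  have hx : ContDiff ℝ ∞ (fun x : E d => x i) := by fun_prop
  have eq : (fun x => q x i) = (fun x => q₀ x i) + (fun x : E d => x i) * q₁ := by
    funext x
    simp [e x, mul_comm]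
  rw [eq]
  exact (hγt i).add (hgt.smooth_mul hx)

end Polytope

end HdivElement

end

theorem mainTheorem3 {d : ℕ} (hd : 1 ≤ d) (K : HdivElement.Polytope d) (c : K.FaceCoordinates)
    (l₁ l₂ m₁ m₂ : ℤ) :
    (∀ q ∈ K.spaceH c l₁ l₂ m₁ m₂,
      (∃ h ∈ K.boundaryPoly c (max l₁ l₂), K.IsNormalTrace q h) ∧
      (∃ g, MemLp g 2 K.vol ∧ K.HasWeakDiv q g)) ∧
    K.spaceH c l₁ l₂ m₁ m₂ ⊆ K.Hdiv := by
  refine ⟨fun q hq => ?_, fun q hq => ?_⟩ <;>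
    obtain ⟨γ, g, hγ, hg, htr⟩ := HdivElement.Polytope.exists_traces_of_mem_spaceH hq
  · exact ⟨HdivElement.Polytope.exists_normalTrace hγ hg htr,
      HdivElement.Polytope.exists_hasWeakDiv fun i => (htr i).1⟩
  · exact ⟨HdivElement.Polytope.memLp_of_components fun i => (htr i).1.1,
      HdivElement.Polytope.exists_hasWeakDiv fun i => (htr i).1⟩
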